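/- Let $\mu$ be a probability measure on a measurable space $E$, with real Hilbert space $L^2(\mu)$ and inner product $\langle f,g\rangle_\mu=\int fg\,d\mu$. Let $Q:L^2(\mu)\to L^2(\mu)$ be an isometric involution, i.e. linear with $\langle Qf,Qg\rangle_\mu=\langle f,g\rangle_\mu$ and $Q^2=\mathrm{Id}$. Let $\{P_{t,1}\}_{t\ge 0}$ and $\{P_{t,2}\}_{t\ge0}$ be strongly continuous Markov semigroups on $L^2(\mu)$ with invariant distribution $\mu$ which are $(\mu,Q)$-self-adjoint: $\langle P_{t,i}f,g\rangle_\mu=\langle f,QP_{t,i}Qg\rangle_\mu$ for all $f,g\in L^2(\mu)$, $t\ge0$. Let $L_i$, with domain $D(L_i)$, be their $L^2(\mu)$-generators. For an operator $L$ on $L^2(\mu)$ and $f\in D(L)$ put $\mathcal E(f,L):=\langle f,-Lf\rangle_\mu$; here $QL_i$ has domain $D(L_i)$, $L_iQ$ has domain $\{f: Qf\in D(L_i)\}$, and differences have the intersection of the domains. For a semigroup with generator $L$ and $\lambda>0$, let $R_\lambda f:=\int_0^\infty e^{-\lambda t}P_tf\,dt$ be its resolvent and $\mathrm{var}_\lambda(f,L):=2\langle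 f,R_\lambda f\rangle_\mu$. Assume: (A) $L_1$ and $L_2$ have a common core $\mathcal A$ (a linear subspace), dense in $L^2(\mu)$, with $Q\mathcal A\subset\mathcal A$. For every $\beta\in[1,2]$ the operator $(2-\beta)L_1+(\beta-1)L_2$ with domain $D(L_1)\cap D(L_2)$ has an extension that is the generator $L(\beta)$ of a unique strongly continuous contraction semigroup $\{P_t(\beta)\}_{t\ge0}$ on $L^2(\mu)$ with invariant distribution $\mu$; and $P_t(\beta)f\in\mathcal A$ for all $f\in\mathcal A$, $t\ge0$. Let $R_\lambda(\beta)$ be the resolvent of $\{P_t(\beta)\}_{t\ge0}$. (B) For all $\lambda>0$, $\beta\in[1,2]$ and $f\in\mathcal A$: $R_\lambda(\beta)f\in D(L_1)\cap D(L_2)$, and there are $g_n\in\mathcal A$ with $(L_1-L_2)g_n\to(L_1-L_2)R_\lambda(\beta)f$ in $L^2(\mu)$. (C) For all $\lambda>0$ and $f\in\mathcal A$, the map $[1,2)\ni\beta\mapsto R_\lambda(\beta)f\in L^2(\mu)$ is right differentiable in norm with right derivative $\partial_\beta R_\lambda(\beta)f=R_\lambda(\beta)(L_2-L_1)R_\lambda(\beta)f$,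 and $\beta\mapsto\langle f,\partial_\beta R_\lambda(\beta)f\rangle_\mu$ is continuous on $[1,2)$. (D) Either $\mathcal E(g,QL_1-QL_2)\ge0$ for all $g\in\mathcal A$, or $\mathcal E(g,L_1Q-L_2Q)\ge0$ for all $g\in\mathcal A$. Then for every $\lambda>0$: 1. for every $f\in\mathcal A$ with $Qf=f$ and every $\beta\in[1,2)$, the map $\beta\mapsto\langle f,R_\lambda(\beta)f\rangle_\mu$ has at $\beta$ the right derivative $$\partial_\beta\langle f,R_\lambda(\beta)f\rangle_\mu=\mathcal E\big(QR_\lambda(\beta)f,\,L_1Q-L_2Q\big)=\mathcal E\big(R_\lambda(\beta)f,\,QL_1-QL_2\big)\ge0;$$ 2. for every $f\in L^2(\mu)$ with $Qf=f$, $$\mathrm{var}_\lambda(f,L_1)=2\langle f,R_\lambda(1)f\rangle_\mu\;\le\;\mathrm{var}_\lambda(f,L_2)=2\langle f,R_\lambda(2)f\rangle_\mu .$$ -/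

import Mathlib

open MeasureTheory Filter Topology Set

noncomputable section

namespace MuQ

/-! Semigroups of bounded operators are families `T : ℝ → H →L[ℝ] H`; only the operators `T t`
with `0 ≤ t` are meaningful, and nothing is assumed or claimed about `T t` for `t < 0`. -/

section Semigroups

variable {H : Type*} [NormedAddCommGroup H] [NormedSpace ℝ H]

/-- Strongly continuous one-parameter semigroups of bounded operators on `H`. -/
structure IsStronglyContinuousSemigroup (T : ℝ → H →L[ℝ] H) : Prop where
  zero : T 0 = ContinuousLinearMap.id ℝ H
  add : ∀ s t : ℝ, 0 ≤ s → 0 ≤ t → T (s + t) = (T s).comp (T t)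
  tendsto_zero : ∀ f : H, Tendsto (fun t => T t f) (𝓝[>] 0) (𝓝 f)

/-- Strongly continuous semigroups of contractions on `H`. -/
structure IsContractionSemigroup (T : ℝ → H →L[ℝ] H) : Prop
    extends IsStronglyContinuousSemigroup T where
  norm_le : ∀ t : ℝ, 0 ≤ t → ∀ f : H, ‖T t f‖ ≤ ‖f‖

/-- The graph of the generator: all pairs `(f, g)` with `t⁻¹ (T t - Id) f → g` as `t ↓ 0`. -/
def generatorGraph (T : ℝ → H →L[ℝ] H) : Submodule ℝ (H × H) where
  carrier := {p | Tendsto (fun t : ℝ => t⁻¹ • (T t p.1 - p.1)) (𝓝[>] 0) (𝓝 p.2)}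
  add_mem' := by
    intro p q hp hq
    have hpq := Tendsto.add hp hq
    refine hpq.congr fun t => ?_
    simp only [Prod.fst_add, map_add, ← smul_add]
    congr 1
    abel
  zero_mem' := by simp
  smul_mem' := by
    intro c p hp
    have hc := Tendsto.const_smul hp c
    refine hc.congr fun t => ?_
    simp only [Prod.smul_fst, map_smul, ← smul_sub]
    rw [smul_comm]

/-- The generator of `T`: its domain consists of all `f` such that `t⁻¹ (T t - Id) f` converges
in `H` as `t ↓ 0`, and its value at `f` is that limit. -/
def generator (T : ℝ → H →L[ℝ] H) : H →ₗ.[ℝ] H := (generatorGraph T).toLinearPMap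

/-- The generator is the operator with graph `generatorGraph T`. -/
theorem mem_graph_generator_iff (T : ℝ → H →L[ℝ] H) (f g : H) :
    (f, g) ∈ (generator T).graph ↔
      Tendsto (fun t : ℝ => t⁻¹ • (T t f - f)) (𝓝[>] 0) (𝓝 g) := by
  have hg : ∀ x ∈ generatorGraph T, x.1 = 0 → x.2 = 0 := by
    intro x hx hx0
    have hx' : Tendsto (fun t : ℝ => t⁻¹ • (T t x.1 - x.1)) (𝓝[>] 0) (𝓝 x.2) := hx
    rw [hx0] at hx'
    simp only [map_zero, sub_zero, smul_zero] at hx'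
    exact tendsto_nhds_unique hx' tendsto_const_nhds
  rw [generator, Submodule.toLinearPMap_graph_eq _ hg]
  rfl

/-- The resolvent `R_λ f = ∫₀^∞ e^{-λ t} T t f dt` (Bochner integral in `H`). -/
def resolvent (T : ℝ → H →L[ℝ] H) (lam : ℝ) (f : H) : H :=
  ∫ t in Ioi (0 : ℝ), Real.exp (-(lam * t)) • T t f

/-- The operator `Q L`, with the domain of `L`. -/
def compLeft (Q : H →ₗ[ℝ] H) (L : H →ₗ.[ℝ] H) : H →ₗ.[ℝ] H := Q.compPMap L

/-- The operator `L Q`, with domain `{f | Q f ∈ D(L)}`. -/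
def compRight (L : H →ₗ.[ℝ] H) (Q : H →ₗ[ℝ] H) : H →ₗ.[ℝ] H where
  domain := L.domain.comap Q
  toFun :=
    { toFun := fun f => L ⟨Q f, f.2⟩
      map_add' := fun f g => by
        rw [← L.map_add]
        congr 1
        exact Subtype.ext (map_add Q (f : H) (g : H))
      map_smul' := fun c f => by
        rw [RingHom.id_apply, ← L.map_smul]
        congr 1
        exact Subtype.ext (map_smul Q c (f : H)) }

end Semigroups

section L2

variable {E : Type*} [MeasurableSpace E] {μ : Measure E}

/-- The Dirichlet form `ℰ(f, L) = ⟨f, -L f⟩_μ` of an operator on `L²(μ)`, for `f` in its domain. -/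
def dirichletForm (L : Lp ℝ 2 μ →ₗ.[ℝ] Lp ℝ 2 μ) (f : L.domain) : ℝ :=
  inner ℝ (f : Lp ℝ 2 μ) (-(L f))

/-- Isometric involutions of `L²(μ)`. -/
structure IsIsometricInvolution (Q : Lp ℝ 2 μ →ₗ[ℝ] Lp ℝ 2 μ) : Prop where
  inner_map_map : ∀ f g : Lp ℝ 2 μ, inner ℝ (Q f) (Q g) = inner ℝ f g
  map_map : ∀ f : Lp ℝ 2 μ, Q (Q f) = f

/-- `μ` is invariant for the operators `T t`, `t ≥ 0`. -/
def LeavesInvariant (μ : Measure E) (T : ℝ → Lp ℝ 2 μ →L[ℝ] Lp ℝ 2 μ) : Prop :=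
  ∀ t : ℝ, 0 ≤ t → ∀ f : Lp ℝ 2 μ, ∫ x, T t f x ∂μ = ∫ x, f x ∂μ

/-- Strongly continuous Markov semigroups on `L²(μ)` with invariant distribution `μ`: the
operators `T t` preserve positivity and the constant function `1`, and leave `μ` invariant. -/
structure IsMarkovSemigroup [IsFiniteMeasure μ] (T : ℝ → Lp ℝ 2 μ →L[ℝ] Lp ℝ 2 μ) : Prop
    extends IsStronglyContinuousSemigroup T where
  nonneg : ∀ t : ℝ, 0 ≤ t → ∀ f : Lp ℝ 2 μ, 0 ≤ f → 0 ≤ T t f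
  map_one : ∀ t : ℝ, 0 ≤ t → T t (Lp.const 2 μ (1 : ℝ)) = Lp.const 2 μ (1 : ℝ)
  invariant : LeavesInvariant μ T

/-- `(μ, Q)`-self-adjoint semigroups: `⟨T t f, g⟩ = ⟨f, Q (T t) Q g⟩` for all `t ≥ 0`. -/
def IsQSelfAdjoint (Q : Lp ℝ 2 μ →ₗ[ℝ] Lp ℝ 2 μ) (T : ℝ → Lp ℝ 2 μ →L[ℝ] Lp ℝ 2 μ) : Prop :=
  ∀ t : ℝ, 0 ≤ t → ∀ f g : Lp ℝ 2 μ, inner ℝ (T t f) g = inner ℝ f (Q (T t (Q g)))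

/-- `var_λ(f, L) = 2 ⟨f, R_λ f⟩_μ`, where `R_λ` is the resolvent of the semigroup `T` with
generator `L`. -/
def varLam (T : ℝ → Lp ℝ 2 μ →L[ℝ] Lp ℝ 2 μ) (lam : ℝ) (f : Lp ℝ 2 μ) : ℝ :=
  2 * inner ℝ f (resolvent T lam f)

end L2

end MuQ

end

namespace MuQ

/-! ### Orbits and resolvents of contraction semigroups. -/

section Semigroups

variable {H : Type*} [NormedAddCommGroup H] [NormedSpace ℝ H] {T : ℝ → H →L[ℝ] H}

/-! Put `K = λ - L(β)` on the core and `S_β(x) = ⟨Q K x, x⟩`. By `Q`-self-adjointness `Q K` is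
symmetric, and since `L(β)` is dissipative, `S_β ≥ 0` on vectors with `Qx = x` and `S_β ≤ 0` on
vectors with `Qx = -x`. So `2⟨Qf, x⟩ - S_β(x)` is concave in the even part of `x` and convex in the
odd part. Formally its stationary point is `x = R_λ(β) f`, with saddle value `⟨Qf, R_λ(β) f⟩`. The
ordering hypothesis says that `S_β` decreases as `β` grows, so the saddle value increases.

`R_λ(β) f` need not lie in the core, so the comparison (`inner_le_inner_add_of_forall_inner_le`) is
made for arbitrary core vectors, with an error term that vanishes when both have image `f`. It
passes to the limit because the core is invariant under the semigroup, which makes the range of `K`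
dense (`denseRange`).

This gives monotonicity in `β` directly for every `f` with `Qf = f`. The sign of the right
derivative follows from it, and the derivative formula comes from moving `R_λ(β)` across the inner
product by the symmetry with `Q`. At `β = 1, 2`, uniqueness of the interpolating semigroup
identifies it with the given Markov semigroups, once these are known to be contractions
(`norm_apply_le_of_nonneg`). -/

theorem IsStronglyContinuousSemigroup.comm (hT : IsStronglyContinuousSemigroup T) {s t : ℝ}
    (hs : 0 ≤ s) (ht : 0 ≤ t) (f : H) : T s (T t f) = T t (T s f) := by
  have h₁ := congrArg (fun S => S f) (hT.add s t hs ht)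
  have h₂ := congrArg (fun S => S f) (hT.add t s ht hs)
  rw [add_comm] at h₂
  exact h₁.symm.trans h₂

/-- The semigroup maps the graph of its generator into itself. -/
theorem IsStronglyContinuousSemigroup.mem_graph (hT : IsStronglyContinuousSemigroup T) {f g : H}
    (hfg : (f, g) ∈ (generator T).graph) {t : ℝ} (ht : 0 ≤ t) :
    (T t f, T t g) ∈ (generator T).graph := by
  rw [mem_graph_generator_iff] at hfg ⊢
  refine (((T t).continuous.tendsto g).comp hfg).congr' ?_
  filter_upwards [self_mem_nhdsWithin] with s hs
  simp [hT.comm (le_of_lt hs) ht]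

/-- Orbits in the domain of the generator are right differentiable. -/
theorem IsStronglyContinuousSemigroup.hasDerivWithinAt (hT : IsStronglyContinuousSemigroup T)
    {f g : H} (hfg : (f, g) ∈ (generator T).graph) {t : ℝ} (ht : 0 ≤ t) :
    HasDerivWithinAt (fun s => T s f) (T t g) (Ioi t) t := by
  rw [mem_graph_generator_iff] at hfg
  rw [hasDerivWithinAt_iff_tendsto_slope' (by simp)]
  have hsub : Tendsto (fun s : ℝ => s - t) (𝓝[>] t) (𝓝[>] 0) := by
    refine tendsto_nhdsWithin_of_tendsto_nhds_of_eventually_within _ ?_ ?_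
    · have : Tendsto (fun s : ℝ => s - t) (𝓝 t) (𝓝 (t - t)) :=
        (continuous_id.sub continuous_const).tendsto t
      rw [sub_self] at this
      exact this.mono_left nhdsWithin_le_nhds
    · filter_upwards [self_mem_nhdsWithin] with s hs
      exact sub_pos.2 (mem_Ioi.1 hs)
  refine (((T t).continuous.tendsto g).comp (hfg.comp hsub)).congr' ?_
  filter_upwards [self_mem_nhdsWithin] with s hs
  have h := congrArg (fun S => S f) (hT.add t (s - t) ht (sub_nonneg.2 (le_of_lt hs)))
  simp only [add_sub_cancel, ContinuousLinearMap.comp_apply] at h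
  simp [slope, h]

/-- Contractivity moves continuity from time `0` to all times: `‖T t f - T s f‖ ≤ ‖T |t - s| f -
f‖`. -/
theorem IsContractionSemigroup.continuousOn (hT : IsContractionSemigroup T) (f : H) :
    ContinuousOn (fun t => T t f) (Ici 0) := by
  have h0 : Tendsto (fun t => T t f) (𝓝[≥] 0) (𝓝 f) := by
    have hsplit : 𝓝[≥] (0 : ℝ) = pure 0 ⊔ 𝓝[>] 0 := by
      rw [← nhdsWithin_singleton, ← nhdsWithin_union]
      congr 1
      ext x
      simp [le_iff_eq_or_lt, eq_comm]
    rw [hsplit, tendsto_sup]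
    refine ⟨?_, hT.tendsto_zero f⟩
    rw [tendsto_pure_left]
    intro s hs
    simpa [hT.zero] using mem_of_mem_nhds hs
  have hle : ∀ s t : ℝ, 0 ≤ s → s ≤ t → ‖T t f - T s f‖ ≤ ‖T |t - s| f - f‖ := by
    intro s t hs hst
    have h := congrArg (fun S => S f) (hT.add s (t - s) hs (sub_nonneg.2 hst))
    simp only [add_sub_cancel, ContinuousLinearMap.comp_apply] at h
    rw [h, ← map_sub, abs_of_nonneg (sub_nonneg.2 hst)]
    exact hT.norm_le s hs _
  intro t ht
  rw [ContinuousWithinAt, tendsto_iff_norm_sub_tendsto_zero]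
  have habs : Tendsto (fun s : ℝ => |s - t|) (𝓝[Ici 0] t) (𝓝[≥] 0) := by
    refine tendsto_nhdsWithin_of_tendsto_nhds_of_eventually_within _ ?_
      (Eventually.of_forall fun s => mem_Ici.2 (abs_nonneg _))
    have : Tendsto (fun s : ℝ => |s - t|) (𝓝 t) (𝓝 |t - t|) :=
      (continuous_id.sub continuous_const).abs.tendsto t
    rw [sub_self, abs_zero] at this
    exact this.mono_left nhdsWithin_le_nhds
  have hlim := tendsto_iff_norm_sub_tendsto_zero.1 (h0.comp habs)
  refine tendsto_of_tendsto_of_tendsto_of_le_of_le' tendsto_const_nhds hlim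
    (Eventually.of_forall fun s => norm_nonneg _) ?_
  filter_upwards [self_mem_nhdsWithin] with s hs
  rcases le_total t s with h | h
  · exact hle t s ht h
  · rw [norm_sub_rev]
    simpa [abs_sub_comm] using hle s t hs h

theorem IsContractionSemigroup.continuousOn_exp_smul (hT : IsContractionSemigroup T) (lam : ℝ)
    (f : H) : ContinuousOn (fun t => Real.exp (-(lam * t)) • T t f) (Ici 0) :=
  ContinuousOn.smul (by fun_prop) (hT.continuousOn f)

theorem integrableOn_exp_neg_mul {lam : ℝ} (hlam : 0 < lam) :
    IntegrableOn (fun t : ℝ => Real.exp (-(lam * t))) (Ioi 0) := by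
  simpa only [neg_mul] using exp_neg_integrableOn_Ioi 0 hlam

theorem IsContractionSemigroup.norm_exp_smul_le (hT : IsContractionSemigroup T) (lam : ℝ) (f : H)
    {t : ℝ} (ht : 0 ≤ t) :
    ‖Real.exp (-(lam * t)) • T t f‖ ≤ Real.exp (-(lam * t)) * ‖f‖ := by
  rw [norm_smul, Real.norm_of_nonneg (Real.exp_nonneg _)]
  exact mul_le_mul_of_nonneg_left (hT.norm_le t ht f) (Real.exp_nonneg _)

theorem IsContractionSemigroup.integrableOn (hT : IsContractionSemigroup T) {lam : ℝ}
    (hlam : 0 < lam) (f : H) :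
    IntegrableOn (fun t => Real.exp (-(lam * t)) • T t f) (Ioi 0) := by
  refine Integrable.mono' ((integrableOn_exp_neg_mul hlam).mul_const ‖f‖) ?_ ?_
  · exact ((hT.continuousOn_exp_smul lam f).mono Ioi_subset_Ici_self).aestronglyMeasurable
      measurableSet_Ioi
  · exact (ae_restrict_mem measurableSet_Ioi).mono fun t ht =>
      hT.norm_exp_smul_le lam f (le_of_lt ht)

theorem IsContractionSemigroup.resolvent_sub (hT : IsContractionSemigroup T) {lam : ℝ}
    (hlam : 0 < lam) (f g : H) :
    resolvent T lam (f - g) = resolvent T lam f - resolvent T lam g := by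
  rw [resolvent, resolvent, resolvent, ← integral_sub (hT.integrableOn hlam f)
    (hT.integrableOn hlam g)]
  simp only [map_sub, smul_sub]

theorem IsContractionSemigroup.norm_resolvent_le (hT : IsContractionSemigroup T) {lam : ℝ}
    (hlam : 0 < lam) (f : H) :
    ‖resolvent T lam f‖ ≤ (∫ t in Ioi (0 : ℝ), Real.exp (-(lam * t))) * ‖f‖ := by
  rw [resolvent, ← integral_mul_const]
  exact norm_integral_le_of_norm_le ((integrableOn_exp_neg_mul hlam).mul_const ‖f‖)
    ((ae_restrict_mem measurableSet_Ioi).mono fun t ht => hT.norm_exp_smul_le lam f (le_of_lt ht))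

theorem IsContractionSemigroup.continuous_resolvent (hT : IsContractionSemigroup T) {lam : ℝ}
    (hlam : 0 < lam) : Continuous (resolvent T lam) := by
  refine (LipschitzWith.of_dist_le_mul
    (K := (∫ t in Ioi (0 : ℝ), Real.exp (-(lam * t))).toNNReal) fun f g => ?_).continuous
  rw [dist_eq_norm, dist_eq_norm, ← hT.resolvent_sub hlam,
    Real.coe_toNNReal _ (integral_nonneg fun t => Real.exp_nonneg _)]
  exact hT.norm_resolvent_le hlam _

/-- The resolvent is a left inverse of `λ - L`. -/
theorem IsContractionSemigroup.resolvent_apply [CompleteSpace H] (hT : IsContractionSemigroup T)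
    {lam : ℝ} (hlam : 0 < lam) {f g : H} (hfg : (f, g) ∈ (generator T).graph) :
    resolvent T lam (lam • f - g) = f := by
  have hexp : ∀ t : ℝ, HasDerivAt (fun s : ℝ => Real.exp (-(lam * s)))
      (-(lam * Real.exp (-(lam * t)))) t := by
    intro t
    refine (((hasDerivAt_id t).const_mul lam).neg).exp.congr_deriv ?_
    simp [mul_comm]
  -- The integrand is minus the right derivative of `e^{-λt} T t f`, so its integral over `[0, b]`
  -- telescopes.
  have hderiv : ∀ t : ℝ, 0 ≤ t → HasDerivWithinAt (fun s => Real.exp (-(lam * s)) • T s f)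
      (-(Real.exp (-(lam * t)) • T t (lam • f - g))) (Ioi t) t := by
    intro t ht
    convert! (hexp t).hasDerivWithinAt.smul (hT.hasDerivWithinAt hfg ht) using 1
    simp only [map_sub, map_smul, smul_sub, smul_smul, neg_smul, neg_sub]
    rw [mul_comm lam (Real.exp _), sub_eq_add_neg]
  have hint : ∀ b : ℝ, 0 ≤ b → ∫ t in (0 : ℝ)..b, Real.exp (-(lam * t)) • T t (lam • f - g) =
      f - Real.exp (-(lam * b)) • T b f := by
    intro b hb
    have hsub : uIcc 0 b ⊆ Ici 0 := by
      rw [uIcc_of_le hb]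
      exact Icc_subset_Ici_self
    have h := intervalIntegral.integral_eq_sub_of_hasDeriv_right
      ((hT.continuousOn_exp_smul lam f).mono hsub)
      (fun t ht => hderiv t (by rw [min_eq_left hb] at ht; exact le_of_lt ht.1))
      (((hT.continuousOn_exp_smul lam (lam • f - g)).mono hsub).neg.intervalIntegrable)
    rw [intervalIntegral.integral_neg] at h
    rw [← neg_inj, h]
    simp [hT.zero]
  have hlim := intervalIntegral_tendsto_integral_Ioi 0
    (hT.integrableOn hlam (lam • f - g)) tendsto_id
  refine tendsto_nhds_unique hlim ?_
  have hzero : Tendsto (fun b : ℝ => Real.exp (-(lam * b)) • T b f) atTop (𝓝 0) := by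
    have hexp0 : Tendsto (fun b : ℝ => Real.exp (-(lam * b)) * ‖f‖) atTop (𝓝 0) := by
      have := (Real.tendsto_exp_neg_atTop_nhds_zero.comp
        (tendsto_id.const_mul_atTop hlam)).mul_const ‖f‖
      simpa using this
    refine squeeze_zero_norm' ?_ hexp0
    filter_upwards [eventually_ge_atTop 0] with b hb
    exact hT.norm_exp_smul_le lam f hb
  have := (tendsto_const_nhds (x := f)).sub hzero
  rw [sub_zero] at this
  refine this.congr' ?_
  filter_upwards [eventually_ge_atTop 0] with b hb
  exact (hint b hb).symm

end Semigroups

/-! ### Dissipativity, density of the range, and the saddle-point inequality. -/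

section Hilbert

variable {H : Type*} [NormedAddCommGroup H] [InnerProductSpace ℝ H] {T : ℝ → H →L[ℝ] H}

/-- Generators of contraction semigroups are dissipative. -/
theorem IsContractionSemigroup.inner_generator_nonpos (hT : IsContractionSemigroup T) {f g : H}
    (hfg : (f, g) ∈ (generator T).graph) : inner ℝ g f ≤ 0 := by
  rw [mem_graph_generator_iff] at hfg
  refine le_of_tendsto (hfg.inner (tendsto_const_nhds (x := f))) ?_
  filter_upwards [self_mem_nhdsWithin] with t ht
  have ht' : (0 : ℝ) < t := ht
  rw [real_inner_smul_left, inner_sub_left, real_inner_self_eq_norm_mul_norm]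
  have h := real_inner_le_norm (T t f) f
  have h' := mul_le_mul_of_nonneg_right (hT.norm_le t ht'.le f) (norm_nonneg f)
  exact mul_nonpos_of_nonneg_of_nonpos (inv_nonneg.2 ht'.le) (by linarith)

/-- A dense subspace of the domain which is invariant under the semigroup is mapped by `λ - L`
onto a dense subspace. -/
theorem IsContractionSemigroup.denseRange [CompleteSpace H] (hT : IsContractionSemigroup T)
    {lam : ℝ} (hlam : 0 < lam) {A : Submodule ℝ H} (hA : Dense (A : Set H))
    (hTA : ∀ f ∈ A, ∀ t : ℝ, 0 ≤ t → T t f ∈ A) (l : A →ₗ[ℝ] H)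
    (hl : ∀ a : A, ((a : H), l a) ∈ (generator T).graph) :
    DenseRange (lam • A.subtype - l) := by
  change Dense ((LinearMap.range (lam • A.subtype - l) : Submodule ℝ H) : Set H)
  rw [Submodule.dense_iff_topologicalClosure_eq_top, Submodule.topologicalClosure_eq_top_iff,
    Submodule.eq_bot_iff]
  intro h hh
  have horth : ∀ a : A, inner ℝ h (lam • (a : H) - l a) = 0 := fun a =>
    Submodule.inner_left_of_mem_orthogonal (LinearMap.mem_range_self _ a) hh
  refine hA.eq_zero_of_inner_left (𝕜 := ℝ) fun a ha => ?_
  -- Writing `a` as the resolvent of `λa - La` makes `⟨h, a⟩` an integral of `⟨h, (λ - L) T t a⟩`;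
  -- each of these vanishes because `T t a` stays in `A`.
  rw [← show _ = a from hT.resolvent_apply hlam (hl ⟨a, ha⟩), resolvent,
    ← integral_inner (hT.integrableOn hlam _)]
  rw [setIntegral_congr_fun (g := fun _ => (0 : ℝ)) measurableSet_Ioi, integral_zero]
  intro t ht
  have ht' : (0 : ℝ) ≤ t := le_of_lt ht
  have hmem := hTA a ha t ht'
  have heq : T t (l ⟨a, ha⟩) = l ⟨T t a, hmem⟩ := by
    have h₁ := hT.mem_graph (hl ⟨a, ha⟩) ht'
    have h₂ := hl ⟨T t a, hmem⟩
    rw [mem_graph_generator_iff] at h₁ h₂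
    exact tendsto_nhds_unique h₁ h₂
  simp only [real_inner_smul_right, map_sub, map_smul, heq]
  rw [horth ⟨T t a, hmem⟩, mul_zero]

variable {Q : H →ₗ[ℝ] H} {A : Submodule ℝ H}

/-- Comparison of the values of two saddle-point problems over a `Q`-stable subspace. -/
theorem inner_le_inner_add_of_forall_inner_le (hQs : ∀ x y, inner ℝ (Q x) y = inner ℝ x (Q y))
    (hQQ : ∀ x, Q (Q x) = x) (hQA : ∀ f ∈ A, Q f ∈ A) {K₁ K₂ : A →ₗ[ℝ] H}
    (hs₁ : ∀ a b : A, inner ℝ (Q (K₁ a)) (b : H) = inner ℝ (a : H) (Q (K₁ b)))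
    (hs₂ : ∀ a b : A, inner ℝ (Q (K₂ a)) (b : H) = inner ℝ (a : H) (Q (K₂ b)))
    (hp₁ : ∀ a : A, 0 ≤ inner ℝ (K₁ a) (a : H)) (hp₂ : ∀ a : A, 0 ≤ inner ℝ (K₂ a) (a : H))
    (hle : ∀ a : A, inner ℝ (Q (K₂ a)) (a : H) ≤ inner ℝ (Q (K₁ a)) (a : H)) (a b : A) :
    inner ℝ (Q (K₁ a)) (a : H) ≤ inner ℝ (Q (K₂ b)) (b : H) +
      inner ℝ (Q (K₁ a) - Q (K₂ b)) ((a : H) + Q a + (b - Q b)) := by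
  -- `c` joins the even part of `a` to the odd part of `b`. Hence `a - c` is odd and `b - c` is
  -- even, so the first form is `≤ 0` at `a - c` and the second is `≥ 0` at `b - c`. Expanding both
  -- and comparing the two forms at `c` gives the claim.
  set c : A := (1 / 2 : ℝ) • (a + ⟨Q a, hQA a a.2⟩ + (b - ⟨Q b, hQA b b.2⟩)) with hc
  have hcv : (a : H) + Q a + (b - Q b) = (2 : ℝ) • (c : H) := by
    rw [hc]
    simp [smul_smul]
  have hcv' : (c : H) = (1 / 2 : ℝ) • ((a : H) + Q a + (b - Q b)) := by
    rw [hcv, smul_smul]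
    norm_num
  have hca : Q ((a - c : A) : H) = -((a - c : A) : H) := by
    simp only [Submodule.coe_sub, hcv', map_sub, map_smul, map_add, hQQ]
    module
  have hcb : Q ((b - c : A) : H) = ((b - c : A) : H) := by
    simp only [Submodule.coe_sub, hcv', map_sub, map_smul, map_add, hQQ]
    module
  have h₁ : inner ℝ (Q (K₁ (a - c))) ((a - c : A) : H) ≤ 0 := by
    rw [hQs, hca, inner_neg_right]
    exact neg_nonpos.2 (hp₁ _)
  have h₂ : 0 ≤ inner ℝ (Q (K₂ (b - c))) ((b - c : A) : H) := by
    rw [hQs, hcb]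
    exact hp₂ _
  have h₃ := hle c
  have e₁ := (hs₁ c a).trans (real_inner_comm _ _)
  have e₂ := (hs₂ c b).trans (real_inner_comm _ _)
  rw [hcv]
  simp only [map_sub, Submodule.coe_sub, inner_sub_left, inner_sub_right,
    real_inner_smul_right] at h₁ h₂ ⊢
  linarith

end Hilbert

end MuQ

namespace MuQ

/-! ### From the core to the whole space by density. -/

section Hilbert

variable {H : Type*} [NormedAddCommGroup H] [InnerProductSpace ℝ H] {Q : H →ₗ[ℝ] H}
  {A : Submodule ℝ H}

/-- On the range of `K`, where `R` inverts `K`, this is the symmetry of `Q K`. -/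
theorem inner_map_eq_inner_map_of_denseRange (hQs : ∀ x y, inner ℝ (Q x) y = inner ℝ x (Q y))
    (hQc : Continuous Q) {K : A →ₗ[ℝ] H} (hK : DenseRange K)
    (hs : ∀ a b : A, inner ℝ (Q (K a)) (b : H) = inner ℝ (a : H) (Q (K b)))
    {R : H → H} (hR : Continuous R) (hRK : ∀ a : A, R (K a) = a) (p r : H) :
    inner ℝ (R p) (Q r) = inner ℝ p (Q (R r)) := by
  refine hK.induction_on₂ (p := fun p r => inner ℝ (R p) (Q r) = inner ℝ p (Q (R r))) ?_ ?_ p r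
  · exact isClosed_eq (by fun_prop) (by fun_prop)
  · intro a b
    simp only [hRK]
    rw [← hs, hQs]

/-- The saddle-point inequality with its error term is a closed condition on the pair `(K₁ a, K₂
b)`. Such pairs are dense, and at the limit `(f, f)` the error vanishes. -/
theorem inner_map_le_inner_map_of_denseRange (hQs : ∀ x y, inner ℝ (Q x) y = inner ℝ x (Q y))
    (hQQ : ∀ x, Q (Q x) = x) (hQc : Continuous Q) (hQA : ∀ f ∈ A, Q f ∈ A) {K₁ K₂ : A →ₗ[ℝ] H}
    (hK₁ : DenseRange K₁) (hK₂ : DenseRange K₂)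
    (hs₁ : ∀ a b : A, inner ℝ (Q (K₁ a)) (b : H) = inner ℝ (a : H) (Q (K₁ b)))
    (hs₂ : ∀ a b : A, inner ℝ (Q (K₂ a)) (b : H) = inner ℝ (a : H) (Q (K₂ b)))
    (hp₁ : ∀ a : A, 0 ≤ inner ℝ (K₁ a) (a : H)) (hp₂ : ∀ a : A, 0 ≤ inner ℝ (K₂ a) (a : H))
    (hle : ∀ a : A, inner ℝ (Q (K₂ a)) (a : H) ≤ inner ℝ (Q (K₁ a)) (a : H))
    {R₁ R₂ : H → H} (hR₁ : Continuous R₁) (hR₂ : Continuous R₂) (hRK₁ : ∀ a : A, R₁ (K₁ a) = a)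
    (hRK₂ : ∀ a : A, R₂ (K₂ a) = a) (f : H) :
    inner ℝ (Q f) (R₁ f) ≤ inner ℝ (Q f) (R₂ f) := by
  have hclosed : IsClosed {x : H × H | inner ℝ (Q x.1) (R₁ x.1) ≤ inner ℝ (Q x.2) (R₂ x.2) +
      inner ℝ (Q x.1 - Q x.2) (R₁ x.1 + Q (R₁ x.1) + (R₂ x.2 - Q (R₂ x.2)))} :=
    isClosed_le (by fun_prop) (by fun_prop)
  have hmem : (f, f) ∈ closure (range (Prod.map K₁ K₂)) := (hK₁.prodMap hK₂) _
  have h := closure_minimal ?_ hclosed hmem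
  · simpa using h
  · rintro _ ⟨⟨a, b⟩, rfl⟩
    have h := inner_le_inner_add_of_forall_inner_le hQs hQQ hQA hs₁ hs₂ hp₁ hp₂ hle a b
    simpa only [mem_ofPred_eq, Prod.map_apply, hRK₁, hRK₂] using h

end Hilbert

/-! ### Markov contractivity and `Q`-symmetry on `L²(μ)`. -/

section L2

variable {E : Type*} [MeasurableSpace E] {μ : Measure E}

theorem IsIsometricInvolution.inner_left {Q : Lp ℝ 2 μ →ₗ[ℝ] Lp ℝ 2 μ}
    (hQ : IsIsometricInvolution Q) (f g : Lp ℝ 2 μ) : inner ℝ (Q f) g = inner ℝ f (Q g) := by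
  rw [← hQ.inner_map_map f (Q g), hQ.map_map]

theorem IsIsometricInvolution.continuous {Q : Lp ℝ 2 μ →ₗ[ℝ] Lp ℝ 2 μ}
    (hQ : IsIsometricInvolution Q) : Continuous Q :=
  AddMonoidHomClass.continuous_of_bound Q 1 fun f => by
    rw [one_mul, @norm_eq_sqrt_real_inner _ _ _ (Q f), hQ.inner_map_map,
      ← norm_eq_sqrt_real_inner]

/-- Positive operators on `L²(μ)` which fix the constants and leave `μ` invariant are
contractions. -/
theorem norm_apply_le_of_nonneg [IsFiniteMeasure μ] {S : Lp ℝ 2 μ →L[ℝ] Lp ℝ 2 μ}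
    (hpos : ∀ f, 0 ≤ f → 0 ≤ S f) (hone : S (Lp.const 2 μ (1 : ℝ)) = Lp.const 2 μ (1 : ℝ))
    (hinv : ∀ f, ∫ x, S f x ∂μ = ∫ x, f x ∂μ) (f : Lp ℝ 2 μ) : ‖S f‖ ≤ ‖f‖ := by
  -- For simple `f` the square `f²` is again in `L²(μ)`, so `S` can be applied to it.
  refine (Lp.simpleFunc.denseRange (E := ℝ) (μ := μ) (p := 2) (by simp)).induction_on
    (p := fun f => ‖S f‖ ≤ ‖f‖) f (isClosed_le (by fun_prop) (by fun_prop)) fun s => ?_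
  set u := Lp.simpleFunc.toSimpleFunc s with hu
  set f : Lp ℝ 2 μ := s.1 with hf
  have hfu : f =ᵐ[μ] u := (Lp.simpleFunc.toSimpleFunc_eq_toFun s).symm
  have hmem : MemLp (u.map fun y => y ^ 2) 2 μ := SimpleFunc.memLp_of_isFiniteMeasure _ _ _
  set g : Lp ℝ 2 μ := hmem.toLp _ with hg
  have hgf : ∀ᵐ x ∂μ, g x = f x ^ 2 := by
    filter_upwards [hmem.coeFn_toLp, hfu] with x h₁ h₂
    rw [hg, h₁, h₂, SimpleFunc.map_apply]
  have hconst : ∀ᵐ x ∂μ, Lp.const 2 μ (1 : ℝ) x = 1 := Lp.coeFn_const 2 μ 1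
  -- Positivity of `S` applied to `(f - q)²`. Rational `q` allow a single null set; optimizing over
  -- real `q` then gives `(S f)² ≤ S(f²)`.
  have hjensen : ∀ᵐ x ∂μ, ∀ q : ℚ, 0 ≤ S g x - 2 * q * S f x + q ^ 2 := by
    rw [ae_all_iff]
    intro q
    have h₀ : 0 ≤ g - (2 * q : ℝ) • f + (q ^ 2 : ℝ) • Lp.const 2 μ (1 : ℝ) := by
      rw [← Lp.coeFn_nonneg]
      filter_upwards [Lp.coeFn_add (g - (2 * q : ℝ) • f) ((q ^ 2 : ℝ) • Lp.const 2 μ (1 : ℝ)),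
        Lp.coeFn_sub g ((2 * q : ℝ) • f), Lp.coeFn_smul (2 * q : ℝ) f,
        Lp.coeFn_smul (q ^ 2 : ℝ) (Lp.const 2 μ (1 : ℝ)), hgf, hconst] with x h₁ h₂ h₃ h₄ h₅ h₆
      simp only [h₁, h₂, h₃, h₄, h₅, h₆, Pi.add_apply, Pi.sub_apply, Pi.smul_apply, smul_eq_mul,
        Pi.zero_apply]
      nlinarith [sq_nonneg (f x - q)]
    have h := hpos _ h₀
    simp only [map_add, map_sub, map_smul, hone] at h
    rw [← Lp.coeFn_nonneg] at h
    filter_upwards [h, Lp.coeFn_add (S g - (2 * q : ℝ) • S f)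
        ((q ^ 2 : ℝ) • Lp.const 2 μ (1 : ℝ)),
      Lp.coeFn_sub (S g) ((2 * q : ℝ) • S f), Lp.coeFn_smul (2 * q : ℝ) (S f),
      Lp.coeFn_smul (q ^ 2 : ℝ) (Lp.const 2 μ (1 : ℝ)), hconst] with x h₀ h₁ h₂ h₃ h₄ h₅
    simpa only [h₁, h₂, h₃, h₄, h₅, Pi.add_apply, Pi.sub_apply, Pi.smul_apply, smul_eq_mul,
        Pi.zero_apply, mul_one] using h₀
  have hsq : ∀ᵐ x ∂μ, S f x * S f x ≤ S g x := by
    filter_upwards [hjensen] with x hx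
    have hreal : ∀ y : ℝ, 0 ≤ S g x - 2 * y * S f x + y ^ 2 := fun y =>
      Rat.denseRange_cast.induction_on (p := fun y : ℝ => 0 ≤ S g x - 2 * y * S f x + y ^ 2) y
        (isClosed_le (by fun_prop) (by fun_prop)) hx
    nlinarith [hreal (S f x)]
  refine le_of_sq_le_sq ?_ (norm_nonneg _)
  rw [← real_inner_self_eq_norm_sq, ← real_inner_self_eq_norm_sq, L2.inner_def, L2.inner_def]
  calc ∫ x, inner ℝ (S f x) (S f x) ∂μ ≤ ∫ x, S g x ∂μ := by
        refine integral_mono_ae (L2.integrable_inner (S f) (S f))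
          ((Lp.memLp (S g)).integrable (by norm_num)) ?_
        filter_upwards [hsq] with x hx
        simpa [sq] using hx
    _ = ∫ x, g x ∂μ := hinv g
    _ = ∫ x, inner ℝ (f x) (f x) ∂μ := by
        refine integral_congr_ae ?_
        filter_upwards [hgf] with x hx
        simp [hx, sq]

theorem IsMarkovSemigroup.isContractionSemigroup [IsFiniteMeasure μ]
    {T : ℝ → Lp ℝ 2 μ →L[ℝ] Lp ℝ 2 μ} (hT : IsMarkovSemigroup T) : IsContractionSemigroup T where
  toIsStronglyContinuousSemigroup := hT.toIsStronglyContinuousSemigroup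
  norm_le t ht := norm_apply_le_of_nonneg (hT.nonneg t ht) (hT.map_one t ht) (hT.invariant t ht)

/-- `Q L` is symmetric for the generator `L` of a `(μ, Q)`-self-adjoint semigroup. -/
theorem IsQSelfAdjoint.inner_generator {Q : Lp ℝ 2 μ →ₗ[ℝ] Lp ℝ 2 μ}
    (hQ : IsIsometricInvolution Q) {T : ℝ → Lp ℝ 2 μ →L[ℝ] Lp ℝ 2 μ} (hT : IsQSelfAdjoint Q T)
    {f f' g g' : Lp ℝ 2 μ} (hf : (f, f') ∈ (generator T).graph)
    (hg : (g, g') ∈ (generator T).graph) : inner ℝ (Q f') g = inner ℝ f (Q g') := by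
  rw [mem_graph_generator_iff] at hf hg
  rw [hQ.inner_left]
  refine tendsto_nhds_unique (hf.inner (tendsto_const_nhds (x := Q g))) ?_
  refine ((tendsto_const_nhds (x := f)).inner ((hQ.continuous.tendsto g').comp hg)).congr' ?_
  filter_upwards [self_mem_nhdsWithin] with t ht
  have ht' : (0 : ℝ) < t := ht
  simp only [Function.comp_apply, map_smul, map_sub, real_inner_smul_left, real_inner_smul_right,
    inner_sub_left, inner_sub_right]
  rw [hT t ht'.le, hQ.map_map]

end L2

theorem resolvent_congr {H : Type*} [NormedAddCommGroup H] [NormedSpace ℝ H]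
    {S T : ℝ → H →L[ℝ] H} (h : ∀ t, 0 ≤ t → S t = T t) (lam : ℝ) (f : H) :
    resolvent S lam f = resolvent T lam f :=
  setIntegral_congr_fun measurableSet_Ioi fun t ht => by simp only [h t (le_of_lt ht)]

/-- The right derivative of a function that stays above its initial value is nonnegative. -/
theorem nonneg_of_hasDerivWithinAt_Ici {φ : ℝ → ℝ} {d a b : ℝ} (hab : a < b)
    (hφ : HasDerivWithinAt φ d (Ici a) a) (hle : ∀ x ∈ Ioo a b, φ a ≤ φ x) : 0 ≤ d := by
  replace hφ := (hasDerivWithinAt_iff_tendsto_slope' self_notMem_Ioi).1 (hφ.mono Ioi_subset_Ici_self)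
  refine ge_of_tendsto hφ ?_
  filter_upwards [Ioo_mem_nhdsGT hab] with x hx
  rw [slope_def_field]
  exact div_nonneg (sub_nonneg.2 (hle x hx)) (sub_nonneg.2 hx.1.le)

end MuQ

/-! ### Monotonicity along the interpolation, and the main theorem. -/

theorem mainTheorem9 {E : Type*} [MeasurableSpace E] (μ : Measure E) [IsProbabilityMeasure μ]
    (Q : Lp ℝ 2 μ →ₗ[ℝ] Lp ℝ 2 μ) (hQ : MuQ.IsIsometricInvolution Q)
    -- the two semigroups and their generators
    (P₁ P₂ : ℝ → Lp ℝ 2 μ →L[ℝ] Lp ℝ 2 μ)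
    (hP₁ : MuQ.IsMarkovSemigroup P₁) (hP₂ : MuQ.IsMarkovSemigroup P₂)
    (hsa₁ : MuQ.IsQSelfAdjoint Q P₁) (hsa₂ : MuQ.IsQSelfAdjoint Q P₂)
    (L₁ L₂ : Lp ℝ 2 μ →ₗ.[ℝ] Lp ℝ 2 μ)
    (hL₁ : L₁ = MuQ.generator P₁) (hL₂ : L₂ = MuQ.generator P₂)
    -- the common core, dense in `L²(μ)` and stable under `Q`
    (A : Submodule ℝ (Lp ℝ 2 μ)) (hA₁ : L₁.HasCore A) (hA₂ : L₂.HasCore A)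
    (hAdense : Dense (A : Set (Lp ℝ 2 μ))) (hQA : ∀ f ∈ A, Q f ∈ A)
    -- the interpolating semigroups
    (P : ℝ → ℝ → Lp ℝ 2 μ →L[ℝ] Lp ℝ 2 μ)
    (hP : ∀ β ∈ Icc (1 : ℝ) 2, MuQ.IsContractionSemigroup (P β) ∧ MuQ.LeavesInvariant μ (P β) ∧
      (2 - β) • L₁ + (β - 1) • L₂ ≤ MuQ.generator (P β))
    (hPunique : ∀ β ∈ Icc (1 : ℝ) 2, ∀ T : ℝ → Lp ℝ 2 μ →L[ℝ] Lp ℝ 2 μ,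
      MuQ.IsContractionSemigroup T → MuQ.LeavesInvariant μ T →
      (2 - β) • L₁ + (β - 1) • L₂ ≤ MuQ.generator T → ∀ t : ℝ, 0 ≤ t → T t = P β t)
    (hPA : ∀ β ∈ Icc (1 : ℝ) 2, ∀ f ∈ A, ∀ t : ℝ, 0 ≤ t → P β t f ∈ A)
    -- first condition
    (h₁ : ∀ lam : ℝ, 0 < lam → ∀ β ∈ Icc (1 : ℝ) 2, ∀ f ∈ A,
      ∃ hR : MuQ.resolvent (P β) lam f ∈ (L₁ - L₂).domain,
      ∃ g : ℕ → (L₁ - L₂).domain, (∀ n, (g n : Lp ℝ 2 μ) ∈ A) ∧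
        Tendsto (fun n => (L₁ - L₂) (g n)) atTop (𝓝 ((L₁ - L₂) ⟨_, hR⟩)))
    -- second condition: the right derivative of the resolvent, and its weak continuity
    (h₂ : ∀ lam : ℝ, 0 < lam → ∀ f ∈ A,
      (∀ β ∈ Ico (1 : ℝ) 2, ∃ hR : MuQ.resolvent (P β) lam f ∈ (L₂ - L₁).domain,
        HasDerivWithinAt (fun b : ℝ => MuQ.resolvent (P b) lam f)
          (MuQ.resolvent (P β) lam ((L₂ - L₁) ⟨_, hR⟩)) (Ici β) β) ∧
      ContinuousOn (fun β : ℝ =>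
        (inner ℝ f (derivWithin (fun b : ℝ => MuQ.resolvent (P b) lam f) (Ici β) β) : ℝ))
        (Ico (1 : ℝ) 2))
    -- third condition: the ordering of the Dirichlet forms on the core
    (h₃ : (∀ g : (MuQ.compLeft Q L₁ - MuQ.compLeft Q L₂).domain, (g : Lp ℝ 2 μ) ∈ A →
        0 ≤ MuQ.dirichletForm (MuQ.compLeft Q L₁ - MuQ.compLeft Q L₂) g) ∨
      (∀ g : (MuQ.compRight L₁ Q - MuQ.compRight L₂ Q).domain, (g : Lp ℝ 2 μ) ∈ A →
        0 ≤ MuQ.dirichletForm (MuQ.compRight L₁ Q - MuQ.compRight L₂ Q) g)) :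
    (∀ lam : ℝ, 0 < lam → ∀ f ∈ A, Q f = f → ∀ β ∈ Ico (1 : ℝ) 2,
      ∃ (hQR : Q (MuQ.resolvent (P β) lam f) ∈ (MuQ.compRight L₁ Q - MuQ.compRight L₂ Q).domain)
        (hR : MuQ.resolvent (P β) lam f ∈ (MuQ.compLeft Q L₁ - MuQ.compLeft Q L₂).domain),
        HasDerivWithinAt (fun b : ℝ => (inner ℝ f (MuQ.resolvent (P b) lam f) : ℝ))
          (MuQ.dirichletForm (MuQ.compRight L₁ Q - MuQ.compRight L₂ Q) ⟨_, hQR⟩) (Ici β) β ∧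
        MuQ.dirichletForm (MuQ.compRight L₁ Q - MuQ.compRight L₂ Q) ⟨_, hQR⟩ =
          MuQ.dirichletForm (MuQ.compLeft Q L₁ - MuQ.compLeft Q L₂) ⟨_, hR⟩ ∧
        0 ≤ MuQ.dirichletForm (MuQ.compLeft Q L₁ - MuQ.compLeft Q L₂) ⟨_, hR⟩) ∧
    (∀ lam : ℝ, 0 < lam → ∀ f : Lp ℝ 2 μ, Q f = f →
      MuQ.varLam P₁ lam f = 2 * inner ℝ f (MuQ.resolvent (P 1) lam f) ∧
      MuQ.varLam P₂ lam f = 2 * inner ℝ f (MuQ.resolvent (P 2) lam f) ∧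
      MuQ.varLam P₁ lam f ≤ MuQ.varLam P₂ lam f) := by
  subst hL₁ hL₂
  have hQs := hQ.inner_left
  have hQc := hQ.continuous
  -- the generators on the core, as linear maps
  set l₁ : A →ₗ[ℝ] Lp ℝ 2 μ :=
    (MuQ.generator P₁).toFun ∘ₗ Submodule.inclusion hA₁.le_domain with hl₁
  set l₂ : A →ₗ[ℝ] Lp ℝ 2 μ :=
    (MuQ.generator P₂).toFun ∘ₗ Submodule.inclusion hA₂.le_domain with hl₂
  have hg₁ : ∀ a : A, ((a : Lp ℝ 2 μ), l₁ a) ∈ (MuQ.generator P₁).graph := fun a =>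
    (MuQ.generator P₁).mem_graph (Submodule.inclusion hA₁.le_domain a)
  have hg₂ : ∀ a : A, ((a : Lp ℝ 2 μ), l₂ a) ∈ (MuQ.generator P₂).graph := fun a =>
    (MuQ.generator P₂).mem_graph (Submodule.inclusion hA₂.le_domain a)
  set l : ℝ → A →ₗ[ℝ] Lp ℝ 2 μ := fun β => (2 - β) • l₁ + (β - 1) • l₂ with hl
  have hg : ∀ β ∈ Icc (1 : ℝ) 2, ∀ a : A,
      ((a : Lp ℝ 2 μ), l β a) ∈ (MuQ.generator (P β)).graph := fun β hβ a =>
    LinearPMap.le_graph_of_le (hP β hβ).2.2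
      (((2 - β) • MuQ.generator P₁ + (β - 1) • MuQ.generator P₂).mem_graph
        ⟨a, hA₁.le_domain a.2, hA₂.le_domain a.2⟩)
  -- the ordering on the core
  have hord : ∀ a : A, inner ℝ (Q (l₁ a)) (a : Lp ℝ 2 μ) ≤ inner ℝ (Q (l₂ a)) (a : Lp ℝ 2 μ) := by
    intro a
    rcases h₃ with h₃ | h₃
    · have h : 0 ≤ inner ℝ (a : Lp ℝ 2 μ) (-(Q (l₁ a) - Q (l₂ a))) :=
        h₃ ⟨a, hA₁.le_domain a.2, hA₂.le_domain a.2⟩ a.2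
      rw [inner_neg_right, inner_sub_right, real_inner_comm, real_inner_comm (Q (l₂ a))] at h
      linarith
    -- Evaluating the second alternative at `Q a` reduces it to the first.
    · have hQQa : Q (Q a) ∈ A := by rw [hQ.map_map]; exact a.2
      have hsub : (⟨Q (Q a), hQQa⟩ : A) = a := Subtype.ext (hQ.map_map a)
      have h : 0 ≤ inner ℝ (Q a) (-(l₁ ⟨Q (Q a), hQQa⟩ - l₂ ⟨Q (Q a), hQQa⟩)) :=
        h₃ ⟨Q a, hA₁.le_domain hQQa, hA₂.le_domain hQQa⟩ (hQA a a.2)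
      rw [hsub, inner_neg_right, inner_sub_right, hQs, hQs, real_inner_comm,
        real_inner_comm (Q (l₂ a))] at h
      linarith
  -- `λ - L(β)` on the core
  set K : ℝ → ℝ → A →ₗ[ℝ] Lp ℝ 2 μ := fun lam β => lam • A.subtype - l β with hK
  have hKapply : ∀ lam β (a : A), K lam β a =
      lam • (a : Lp ℝ 2 μ) - ((2 - β) • l₁ a + (β - 1) • l₂ a) := fun _ _ _ => rfl
  have hKdense : ∀ lam, 0 < lam → ∀ β ∈ Icc (1 : ℝ) 2, DenseRange (K lam β) :=
    fun lam hlam β hβ => (hP β hβ).1.denseRange hlam hAdense (hPA β hβ) (l β) (hg β hβ)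
  have hRK : ∀ lam, 0 < lam → ∀ β ∈ Icc (1 : ℝ) 2, ∀ a : A,
      MuQ.resolvent (P β) lam (K lam β a) = a :=
    fun lam hlam β hβ a => (hP β hβ).1.resolvent_apply hlam (hg β hβ a)
  have hRc : ∀ lam, 0 < lam → ∀ β ∈ Icc (1 : ℝ) 2, Continuous (MuQ.resolvent (P β) lam) :=
    fun lam hlam β hβ => (hP β hβ).1.continuous_resolvent hlam
  have hKs : ∀ lam β (a b : A),
      inner ℝ (Q (K lam β a)) (b : Lp ℝ 2 μ) = inner ℝ (a : Lp ℝ 2 μ) (Q (K lam β b)) := by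
    intro lam β a b
    have e₁ := hsa₁.inner_generator hQ (hg₁ a) (hg₁ b)
    have e₂ := hsa₂.inner_generator hQ (hg₂ a) (hg₂ b)
    simp only [hKapply, map_sub, map_add, map_smul, inner_sub_left, inner_add_left,
      inner_sub_right, inner_add_right, real_inner_smul_left, real_inner_smul_right, e₁, e₂, hQs]
  have hKp : ∀ lam, 0 < lam → ∀ β ∈ Icc (1 : ℝ) 2, ∀ a : A,
      0 ≤ inner ℝ (K lam β a) (a : Lp ℝ 2 μ) := by
    intro lam hlam β hβ a
    have h := (hP β hβ).1.inner_generator_nonpos (hg β hβ a)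
    have h' := mul_nonneg hlam.le (real_inner_self_nonneg (x := (a : Lp ℝ 2 μ)))
    rw [hK, LinearMap.sub_apply, inner_sub_left, LinearMap.smul_apply, real_inner_smul_left]
    simp only [Submodule.subtype_apply]
    linarith
  have hmono : ∀ lam, 0 < lam → ∀ β ∈ Icc (1 : ℝ) 2, ∀ γ ∈ Icc (1 : ℝ) 2, β ≤ γ →
      ∀ f, Q f = f → inner ℝ f (MuQ.resolvent (P β) lam f) ≤
        inner ℝ f (MuQ.resolvent (P γ) lam f) := by
    intro lam hlam β hβ γ hγ hβγ f hf
    have h := MuQ.inner_map_le_inner_map_of_denseRange hQs hQ.map_map hQc hQA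
      (hKdense lam hlam β hβ) (hKdense lam hlam γ hγ) (hKs lam β) (hKs lam γ)
      (hKp lam hlam β hβ) (hKp lam hlam γ hγ) ?_ (hRc lam hlam β hβ) (hRc lam hlam γ hγ)
      (hRK lam hlam β hβ) (hRK lam hlam γ hγ) f
    · rwa [hf] at h
    · intro a
      -- The two forms differ by `(γ - β) ⟨Q (L₂ - L₁) a, a⟩`.
      have h := mul_nonneg (sub_nonneg.2 hβγ) (sub_nonneg.2 (hord a))
      simp only [hKapply, map_sub, map_add, map_smul, inner_sub_left, inner_add_left,
        real_inner_smul_left]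
      linarith
  have hRs : ∀ lam, 0 < lam → ∀ β ∈ Icc (1 : ℝ) 2, ∀ p r,
      inner ℝ (MuQ.resolvent (P β) lam p) (Q r) = inner ℝ p (Q (MuQ.resolvent (P β) lam r)) :=
    fun lam hlam β hβ => MuQ.inner_map_eq_inner_map_of_denseRange hQs hQc (hKdense lam hlam β hβ)
      (hKs lam β) (hRc lam hlam β hβ) (hRK lam hlam β hβ)
  refine ⟨fun lam hlam f hfA hf β hβ => ?_, fun lam hlam f hf => ?_⟩
  · have hβ' := Ico_subset_Icc_self hβ
    obtain ⟨hu, hderiv⟩ := (h₂ lam hlam f hfA).1 β hβ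
    set u := MuQ.resolvent (P β) lam f with hu_def
    have hu₁ : u ∈ (MuQ.generator P₁).domain := hu.2
    have hu₂ : u ∈ (MuQ.generator P₂).domain := hu.1
    have hQu₁ : Q (Q u) ∈ (MuQ.generator P₁).domain := by rwa [hQ.map_map]
    have hQu₂ : Q (Q u) ∈ (MuQ.generator P₂).domain := by rwa [hQ.map_map]
    set v₁ := MuQ.generator P₁ ⟨u, hu₁⟩ with hv₁
    set v₂ := MuQ.generator P₂ ⟨u, hu₂⟩ with hv₂
    have hleft : MuQ.dirichletForm (MuQ.compLeft Q (MuQ.generator P₁) -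
        MuQ.compLeft Q (MuQ.generator P₂)) ⟨u, hu₁, hu₂⟩ = inner ℝ (Q u) (v₂ - v₁) := by
      change inner ℝ u (-(Q v₁ - Q v₂)) = _
      rw [hQs, map_sub, neg_sub]
    have hright : MuQ.dirichletForm (MuQ.compRight (MuQ.generator P₁) Q -
        MuQ.compRight (MuQ.generator P₂) Q) ⟨Q u, hQu₁, hQu₂⟩ = inner ℝ (Q u) (v₂ - v₁) := by
      change inner ℝ (Q u) (-(MuQ.generator P₁ ⟨Q (Q u), hQu₁⟩ -
        MuQ.generator P₂ ⟨Q (Q u), hQu₂⟩)) = _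
      rw [neg_sub]
      simp only [hQ.map_map, hv₁, hv₂]
    have hd : HasDerivWithinAt (fun b : ℝ => (inner ℝ f (MuQ.resolvent (P b) lam f) : ℝ))
        (inner ℝ (Q u) (v₂ - v₁)) (Ici β) β := by
      have h := (hasDerivWithinAt_const β (Ici β) f).inner ℝ hderiv
      refine h.congr_deriv ?_
      change inner ℝ f (MuQ.resolvent (P β) lam (v₂ - v₁)) + inner ℝ 0 _ = _
      rw [inner_zero_left, add_zero]
      -- Since `Qf = f`, the symmetry turns `⟨f, R_λ(β)(v₂ - v₁)⟩` into `⟨Qu, v₂ - v₁⟩`.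
      have h' := hRs lam hlam β hβ' (v₂ - v₁) f
      rw [hf, ← hu_def] at h'
      rw [real_inner_comm, h', real_inner_comm]
    refine ⟨⟨hQu₁, hQu₂⟩, ⟨hu₁, hu₂⟩, ?_, ?_, ?_⟩
    · rw [hright]
      exact hd
    · rw [hright, hleft]
    · rw [hleft]
      refine MuQ.nonneg_of_hasDerivWithinAt_Ici hβ.2 hd fun γ hγ => ?_
      exact hmono lam hlam β hβ' γ ⟨hβ.1.trans hγ.1.le, hγ.2.le⟩ hγ.1.le f hf
  · have one_mem : (1 : ℝ) ∈ Icc (1 : ℝ) 2 := by norm_num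
    have two_mem : (2 : ℝ) ∈ Icc (1 : ℝ) 2 := by norm_num
    -- At an endpoint one coefficient is zero, so the interpolated operator is a restriction of a
    -- single generator and uniqueness applies.
    have e₁ : MuQ.resolvent P₁ lam f = MuQ.resolvent (P 1) lam f := by
      refine MuQ.resolvent_congr (hPunique 1 one_mem P₁ hP₁.isContractionSemigroup
        hP₁.invariant ⟨inf_le_left, ?_⟩) lam f
      intro x y hxy
      change (2 - 1 : ℝ) • MuQ.generator P₁ ⟨x, x.2.1⟩ +
        (1 - 1 : ℝ) • MuQ.generator P₂ ⟨x, x.2.2⟩ = _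
      rw [sub_self, zero_smul, add_zero, show (2 - 1 : ℝ) = 1 by norm_num, one_smul]
      congr 1
      exact Subtype.ext hxy
    have e₂ : MuQ.resolvent P₂ lam f = MuQ.resolvent (P 2) lam f := by
      refine MuQ.resolvent_congr (hPunique 2 two_mem P₂ hP₂.isContractionSemigroup
        hP₂.invariant ⟨inf_le_right, ?_⟩) lam f
      intro x y hxy
      change (2 - 2 : ℝ) • MuQ.generator P₁ ⟨x, x.2.1⟩ +
        (2 - 1 : ℝ) • MuQ.generator P₂ ⟨x, x.2.2⟩ = _
      rw [sub_self, zero_smul, zero_add, show (2 - 1 : ℝ) = 1 by norm_num, one_smul]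
      congr 1
      exact Subtype.ext hxy
    rw [MuQ.varLam, MuQ.varLam, e₁, e₂]
    refine ⟨rfl, rfl, ?_⟩
    have h := hmono lam hlam 1 one_mem 2 two_mem one_le_two f hf
    linarith
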